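/- Let $n\ge 1$. The polar $n$-complex numbers are $u=x_0+h_1x_1+\cdots+h_{n-1}x_{n-1}$ with real $x_p$; they form the commutative real algebra with basis $h_0=1,h_1,\dots,h_{n-1}$ and products $h_jh_l=h_{(j+l)\bmod n}$, normed by $|u|=(x_0^2+\cdots+x_{n-1}^2)^{1/2}$. For $1\le k\le [(n-1)/2]$ put $$\xi_k=\sqrt{\tfrac2n}\sum_{p}x_p\cos\tfrac{2\pi kp}{n},\qquad \eta_k=\sqrt{\tfrac2n}\sum_{p}x_p\sin\tfrac{2\pi kp}{n},\qquad \tilde e_k=\tfrac2n\sum_{p}h_p\sin\tfrac{2\pi kp}{n},$$ and write $u_{\xi_k\eta_k}$ and $\Gamma_{\xi_k\eta_k}$ for the projections of a point $u$ and of a loop $\Gamma$ on the $(\xi_k,\eta_k)$ plane. For a closed plane curve $C$ and a point $M\notin C$, $\mathrm{int}(M,C)=1$ if $M$ is interior to $C$ (its connected component in the complement of $C$ is bounded) and $\mathrm{int}(M,C)=0$ if $M$ is exterior to $C$ (that component is unbounded). The closed curve $C$ is called positively oriented if it goes exactly once, counterclockwise, around each of its interior points: a continuous polar angle of the moving point about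 the interior point increases by $2\pi$ along $C$. Let $\Gamma$ be a closed piecewise $C^1$ loop of polar $n$-complex numbers all of whose projections $\Gamma_{\xi_k\eta_k}$, $1\le k\le[(n-1)/2]$, are positively oriented (a projection without interior points, such as a single point, qualifies). All integrals along $\Gamma$ below exist, and the following holds. 1. If $u-u_0$ is invertible for every $u\in\Gamma$, then $$\oint_\Gamma\frac{du}{u-u_0}=\sum_{k=1}^{[(n-1)/2]}2\pi\,\tilde e_k\,\mathrm{int}(u_{0\xi_k\eta_k},\Gamma_{\xi_k\eta_k}).$$ 2. If $u-u_0$ is invertible for every $u\in\Gamma$, and $f(u)=\sum_{j\ge0}c_j(u-u_0)^j$, with absolute convergence, at all points $u$ of $\Gamma$ and of a neighbourhood of $u_0$, then $$\oint_\Gamma\frac{f(u)\,du}{u-u_0}=2\pi f(u_0)\sum_{k=1}^{[(n-1)/2]}\tilde e_k\,\mathrm{int}(u_{0\xi_k\eta_k},\Gamma_{\xi_k\eta_k}).$$ Moreover, for every integer $m\ge0$ the $n$-complex derivatives of $f$ up to order $m+1$ exist near $u_0$ (where $g'(u)$ is the $n$-complex derivative of $g$ at $u$ if $|g(u+h)-g(u)-g'(u)h|=o(|h|)$),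 and $$\oint_\Gamma\frac{f(u)\,du}{(u-u_0)^{m+1}}=\frac{2\pi}{m!}f^{(m)}(u_0)\sum_{k=1}^{[(n-1)/2]}\tilde e_k\,\mathrm{int}(u_{0\xi_k\eta_k},\Gamma_{\xi_k\eta_k}).$$ 3. Let $(u_l)_l$ be any family of polar $n$-complex numbers such that $u-u_l$ is invertible for all $u\in\Gamma$ and all $l$. Suppose that $f=\sum_l F_l$ on $\Gamma$, where $F_l(u)=\sum_{j\in\mathbb Z}r_{l,j}(u-u_l)^j$ with absolute convergence at each $u\in\Gamma$, the sum over $l$ converging unconditionally and uniformly on $\Gamma$ (no condition if there are finitely many $l$). Then, with the residues $r_l=r_{l,-1}$, $$\oint_\Gamma f(u)\,du=2\pi\sum_l\sum_{k=1}^{[(n-1)/2]}\tilde e_k\,\mathrm{int}(u_{l\xi_k\eta_k},\Gamma_{\xi_k\eta_k})\,r_l,$$ the sum over $l$ being unconditionally convergent. -/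

import Mathlib

/-- A polar `n`-complex number `u = x₀ + h₁ x₁ + ⋯ + h_{n-1} x_{n-1}`, given by its real
components `(x₀, …, x_{n-1})`.  The norm is the modulus `|u| = (x₀² + ⋯ + x_{n-1}²)^{1/2}`. -/
def PolarComplex (n : ℕ) : Type := EuclideanSpace ℝ (Fin n)

namespace PolarComplex

noncomputable section

instance (n : ℕ) : NormedAddCommGroup (PolarComplex n) :=
  inferInstanceAs (NormedAddCommGroup (EuclideanSpace ℝ (Fin n)))

instance (n : ℕ) : NormedSpace ℝ (PolarComplex n) :=
  inferInstanceAs (NormedSpace ℝ (EuclideanSpace ℝ (Fin n)))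

instance (n : ℕ) : FiniteDimensional ℝ (PolarComplex n) :=
  inferInstanceAs (FiniteDimensional ℝ (EuclideanSpace ℝ (Fin n)))

/-- The `p`-th real component `x_p` of `u`. -/
def coord {n : ℕ} (u : PolarComplex n) (p : Fin n) : ℝ := WithLp.ofLp u p

/-- The number with given components. -/
def ofCoords {n : ℕ} (x : Fin n → ℝ) : PolarComplex n := WithLp.toLp 2 x

theorem coord_ofCoords {n : ℕ} (x : Fin n → ℝ) (p : Fin n) : coord (ofCoords x) p = x p := rfl

theorem ext_coord {n : ℕ} {u v : PolarComplex n} (h : ∀ p, coord u p = coord v p) : u = v :=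
  PiLp.ext h

theorem coord_add {n : ℕ} (u v : PolarComplex n) (p : Fin n) :
    coord (u + v) p = coord u p + coord v p := rfl

theorem coord_smul {n : ℕ} (r : ℝ) (u : PolarComplex n) (p : Fin n) :
    coord (r • u) p = r * coord u p := rfl

/-- The product determined by `h_j h_l = h_{(j + l) mod n}`: its `k`-th component is
`∑_l x_l x'_{k-l}`, the index `k - l` being taken modulo `n` (subtraction in `Fin n`). -/
instance (n : ℕ) [NeZero n] : Mul (PolarComplex n) where
  mul u v := ofCoords fun k => ∑ l, coord u l * coord v (k - l)

/-- The unity `1 + h₁ · 0 + ⋯ + h_{n-1} · 0`. -/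
instance (n : ℕ) [NeZero n] : One (PolarComplex n) where
  one := ofCoords fun k => if k = 0 then 1 else 0

theorem coord_mul {n : ℕ} [NeZero n] (u v : PolarComplex n) (k : Fin n) :
    coord (u * v) k = ∑ l, coord u l * coord v (k - l) := rfl

theorem coord_one {n : ℕ} [NeZero n] (k : Fin n) :
    coord (1 : PolarComplex n) k = if k = 0 then 1 else 0 := rfl

protected theorem mul_comm' {n : ℕ} [NeZero n] (u v : PolarComplex n) : u * v = v * u := by
  apply ext_coord
  intro k
  rw [coord_mul, coord_mul, ← Equiv.sum_comp (Equiv.subLeft k)]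
  refine Finset.sum_congr rfl fun l _ => ?_
  simp [mul_comm]

protected theorem mul_assoc' {n : ℕ} [NeZero n] (u v w : PolarComplex n) :
    u * v * w = u * (v * w) := by
  apply ext_coord
  intro k
  simp only [coord_mul, Finset.sum_mul, Finset.mul_sum]
  rw [Finset.sum_comm]
  refine Finset.sum_congr rfl fun m _ => ?_
  rw [← Equiv.sum_comp (Equiv.addRight m)]
  refine Finset.sum_congr rfl fun l _ => ?_
  simp only [Equiv.coe_addRight, add_sub_cancel_right]
  rw [mul_assoc, sub_sub, add_comm l m]

protected theorem one_mul' {n : ℕ} [NeZero n] (u : PolarComplex n) : 1 * u = u := by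
  apply ext_coord
  intro k
  simp [coord_mul, coord_one]

protected theorem left_distrib' {n : ℕ} [NeZero n] (u v w : PolarComplex n) :
    u * (v + w) = u * v + u * w := by
  apply ext_coord
  intro k
  simp only [coord_mul, coord_add, mul_add, Finset.sum_add_distrib]

protected theorem zero_mul' {n : ℕ} [NeZero n] (u : PolarComplex n) : 0 * u = 0 := by
  apply ext_coord
  intro k
  have h : ∀ l : Fin n, coord (0 : PolarComplex n) l = 0 := fun _ => rfl
  simp [coord_mul, h]

instance (n : ℕ) [NeZero n] : CommRing (PolarComplex n) where
  __ := (inferInstance : AddCommGroup (PolarComplex n))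
  mul_assoc := PolarComplex.mul_assoc'
  mul_comm := PolarComplex.mul_comm'
  one_mul := PolarComplex.one_mul'
  mul_one u := by rw [PolarComplex.mul_comm', PolarComplex.one_mul']
  left_distrib := PolarComplex.left_distrib'
  right_distrib u v w := by
    rw [PolarComplex.mul_comm', PolarComplex.left_distrib', PolarComplex.mul_comm' w u,
      PolarComplex.mul_comm' w v]
  zero_mul := PolarComplex.zero_mul'
  mul_zero u := by rw [PolarComplex.mul_comm', PolarComplex.zero_mul']

protected theorem smul_mul' {n : ℕ} [NeZero n] (r : ℝ) (u v : PolarComplex n) :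
    r • u * v = r • (u * v) := by
  apply ext_coord
  intro k
  simp only [coord_mul, coord_smul, Finset.mul_sum, mul_assoc]

instance (n : ℕ) [NeZero n] : Algebra ℝ (PolarComplex n) :=
  Algebra.ofModule PolarComplex.smul_mul' fun r u v => by
    rw [mul_comm, PolarComplex.smul_mul', mul_comm]

/-- The canonical base element `ẽ_k = (2/n) ∑_p h_p sin (2πkp/n)`. -/
def eTilde (n k : ℕ) : PolarComplex n :=
  ofCoords fun p => 2 / (n : ℝ) * Real.sin (2 * Real.pi * k * (p : ℕ) / n)

/-- The rotated coordinate `ξ_k = √(2/n) ∑_p x_p cos (2πkp/n)`. -/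
def xi {n : ℕ} (k : ℕ) (u : PolarComplex n) : ℝ :=
  Real.sqrt (2 / n) * ∑ p : Fin n, coord u p * Real.cos (2 * Real.pi * k * (p : ℕ) / n)

/-- The rotated coordinate `η_k = √(2/n) ∑_p x_p sin (2πkp/n)`. -/
def eta {n : ℕ} (k : ℕ) (u : PolarComplex n) : ℝ :=
  Real.sqrt (2 / n) * ∑ p : Fin n, coord u p * Real.sin (2 * Real.pi * k * (p : ℕ) / n)

/-- The projection of `u` on the plane of the axes `ξ_k, η_k`.  The plane is identified with `ℂ`:
the point with coordinates `(ξ_k, η_k)` is `ξ_k + i η_k`. -/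
def proj {n : ℕ} (k : ℕ) (u : PolarComplex n) : ℂ := ⟨xi k u, eta k u⟩

/-- Integer powers `u^j`; for `j < 0` it is the power of the inverse (used only for
invertible `u`). -/
def zpow {n : ℕ} [NeZero n] (u : PolarComplex n) : ℤ → PolarComplex n
  | Int.ofNat m => u ^ m
  | Int.negSucc m => Ring.inverse u ^ (m + 1)

/-- Multiplication by `a`, i.e. the map `du ↦ a du`, as a continuous real-linear map. -/
def mulCLM {n : ℕ} [NeZero n] (a : PolarComplex n) : PolarComplex n →L[ℝ] PolarComplex n :=
  LinearMap.toContinuousLinearMap (LinearMap.mulLeft ℝ a)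

/-- `f'` is the `n`-complex derivative of `f` at `u`:
`f (u + h) - f u - f' h = o(|h|)` as `h → 0`, whatever the direction of approach. -/
def HasPolarDerivAt {n : ℕ} [NeZero n] (f : PolarComplex n → PolarComplex n)
    (f' u : PolarComplex n) : Prop :=
  HasFDerivAt f (mulCLM f') u

open Classical in
/-- The `n`-complex derivative of `f` (zero at points where there is none). -/
def polarDeriv {n : ℕ} [NeZero n] (f : PolarComplex n → PolarComplex n) (u : PolarComplex n) :
    PolarComplex n :=
  if h : ∃ f', HasPolarDerivAt f f' u then h.choose else 0

/-- The `n`-complex derivative of order `m`. -/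
def iteratedPolarDeriv {n : ℕ} [NeZero n] (m : ℕ) (f : PolarComplex n → PolarComplex n) :
    PolarComplex n → PolarComplex n :=
  polarDeriv^[m] f

/-- The path `Γ` is continuous and piecewise continuously differentiable. -/
def IsPiecewiseC1 {n : ℕ} {a b : PolarComplex n} (Γ : Path a b) : Prop :=
  ∃ (m : ℕ) (t : ℕ → ℝ), Monotone t ∧ t 0 = 0 ∧ t m = 1 ∧
    ∀ i < m, ContDiffOn ℝ 1 Γ.extend (Set.Icc (t i) (t (i + 1)))

/-- The integral `∫_Γ g(u) du`, i.e. `∫₀¹ g(Γ(t)) Γ'(t) dt` with the product of `n`-complex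
numbers. -/
def pathIntegral {n : ℕ} [NeZero n] {a b : PolarComplex n} (g : PolarComplex n → PolarComplex n)
    (Γ : Path a b) : PolarComplex n :=
  curveIntegral (fun u => mulCLM (g u)) Γ

/-- The integrand `g(Γ(t)) Γ'(t)` of `∫_Γ g(u) du` is integrable. -/
def PathIntegrable {n : ℕ} [NeZero n] {a b : PolarComplex n}
    (g : PolarComplex n → PolarComplex n) (Γ : Path a b) : Prop :=
  CurveIntegrable (fun u => mulCLM (g u)) Γ

/-- The projection `Γ_{ξ_k η_k}` of the path `Γ` on the plane of the axes `ξ_k, η_k`. -/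
def projPath {n : ℕ} {a b : PolarComplex n} (k : ℕ) (Γ : Path a b) : unitInterval → ℂ :=
  fun t => proj k (Γ t)

end

end PolarComplex

/-- `M` is an interior point of the closed plane curve `C`: it does not lie on `C`, and its
connected component in the complement of `C` is bounded. -/
def IsInteriorPoint (M : ℂ) (C : unitInterval → ℂ) : Prop :=
  M ∉ Set.range C ∧ Bornology.IsBounded (connectedComponentIn (Set.range C)ᶜ M)

open Classical in
/-- The functional `int(M, C)`: it is `1` if `M` is an interior point of `C` and `0` if `M` is
exterior to `C`. -/
noncomputable def interiorIndicator (M : ℂ) (C : unitInterval → ℂ) : ℝ :=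
  if IsInteriorPoint M C then 1 else 0

/-- The closed plane curve `C` turns exactly once, counterclockwise, around `M`: a continuous
choice `φ` of the azimuthal angle of `C(t)` about `M` grows by `2π` along `C`. -/
def TurnsOnceAround (C : unitInterval → ℂ) (M : ℂ) : Prop :=
  ∃ φ : unitInterval → ℝ, Continuous φ ∧
    (∀ t, C t - M = (‖C t - M‖ : ℂ) * Complex.exp (φ t * Complex.I)) ∧
    φ 1 - φ 0 = 2 * Real.pi

/-- The closed plane curve `C` is positively oriented: it goes exactly once, counterclockwise,
around each of its interior points. -/
def IsPositivelyOriented (C : unitInterval → ℂ) : Prop :=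
  ∀ M, IsInteriorPoint M C → TurnsOnceAround C M

/-- The `n`-complex number `∑_{k=1}^{⌊(n-1)/2⌋} ẽ_k int(u_{0 ξ_k η_k}, Γ_{ξ_k η_k})`. -/
noncomputable def PolarComplex.intSum {n : ℕ} {a b : PolarComplex n} (u₀ : PolarComplex n)
    (Γ : Path a b) : PolarComplex n :=
  ∑ k ∈ Finset.Icc 1 ((n - 1) / 2),
    interiorIndicator (PolarComplex.proj k u₀) (PolarComplex.projPath k Γ) •
      PolarComplex.eTilde n k

/-! ### Logarithmic integrals along closed curves in the complex plane -/

section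

open MeasureTheory Set Filter Topology intervalIntegral

/-! The algebra is the group algebra of ℤ/n over ℝ, so the characters `character n k`, χ_k(u) = ∑
x_p ω^{kp} with ω = exp(2πi/n), separate its points (`ext_character`). Since χ_{n-k} is the
conjugate of χ_k, those with k ≤ n/2 suffice. Each χ_k is real-linear and multiplicative, hence
turns an integral along Γ into a complex line integral along χ_k∘Γ. The link with the plane (ξ_k,
η_k) is `proj_eq`: ξ_k + iη_k = √(2/n) χ_k. By `character_eTilde`, χ_j(ẽ_k) is i for j = k and 0 for
other j ≤ n/2.

The claim for du/(u - c) thus reduces to ∮ dz/(z - χ_k(c)) (`integral_inv_character`). This integral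
always lies in 2πiℤ. It is 2πi around an interior point, by the orientation, and 0 around an
exterior one: it is locally constant in the point and small far from the curve. For k = 0 and 2k = n
the curve is real, so the integral is real and vanishes. This is why only 1 ≤ k ≤ (n-1)/2
contribute.

Every other integer power has a primitive and integrates to 0 (`pathIntegral_mul_zpow`). A Laurent
expansion converges uniformly on the compact Γ (`hasSumUniformlyOn_laurent`), so only its residue
survives (`pathIntegral_laurent`). In Cauchy's formula the residue of f(u)/(u - u₀)^{m+1} is c_m,
identified with f^{(m)}(u₀)/m! by termwise differentiation (`iteratedPolarDeriv_center`). -/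

theorem isDiscrete_range_intCast : IsDiscrete (range ((↑) : ℤ → ℝ)) :=
  ⟨(Int.isClosedEmbedding_coe_real.isEmbedding.toHomeomorph.symm.isEmbedding).discreteTopology⟩

/-- `γ` is continuous, `γ'` is integrable on `[0, 1]`, and off a countable set `γ'` is the
derivative of `γ` and is continuous. -/
structure HasPiecewiseDeriv {E : Type*} [NormedAddCommGroup E] [NormedSpace ℝ E]
    (γ γ' : ℝ → E) : Prop where
  continuous : Continuous γ
  off_countable : ∃ s : Set ℝ, s.Countable ∧
    ∀ t ∈ Ioo (0 : ℝ) 1 \ s, HasDerivAt γ (γ' t) t ∧ ContinuousAt γ' t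
  integrable : IntervalIntegrable γ' volume 0 1

namespace HasPiecewiseDeriv

theorem clm_comp {E F : Type*} [NormedAddCommGroup E] [NormedSpace ℝ E] [NormedAddCommGroup F]
    [NormedSpace ℝ F] {γ γ' : ℝ → E} (h : HasPiecewiseDeriv γ γ') (L : E →L[ℝ] F) :
    HasPiecewiseDeriv (fun t => L (γ t)) (fun t => L (γ' t)) := by
  obtain ⟨s, hs, hd⟩ := h.off_countable
  refine ⟨L.continuous.comp h.continuous, ⟨s, hs, fun t ht => ⟨?_, ?_⟩⟩, ?_⟩
  · exact L.hasFDerivAt.comp_hasDerivAt t (hd t ht).1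
  · exact L.continuous.continuousAt.comp (hd t ht).2
  · exact ⟨L.integrable_comp h.integrable.1, L.integrable_comp h.integrable.2⟩

theorem norm_integral_mul_le {γ γ' : ℝ → ℂ} (h : HasPiecewiseDeriv γ γ') {g : ℝ → ℂ} {C : ℝ}
    (hg : ∀ t, ‖g t‖ ≤ C) :
    ‖∫ t in (0 : ℝ)..1, g t * γ' t‖ ≤ C * ∫ t in (0 : ℝ)..1, ‖γ' t‖ := by
  rw [← intervalIntegral.integral_const_mul]
  refine intervalIntegral.norm_integral_le_of_norm_le zero_le_one ?_ (h.integrable.norm.const_mul C)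
  refine Filter.Eventually.of_forall fun t _ => ?_
  rw [norm_mul]
  exact mul_le_mul_of_nonneg_right (hg t) (norm_nonneg _)

variable {z z' : ℝ → ℂ} (h : HasPiecewiseDeriv z z')
include h

theorem integrable_mul {g : ℝ → ℂ} (hg : Continuous g) :
    IntervalIntegrable (fun t => g t * z' t) volume 0 1 :=
  h.integrable.continuousOn_mul hg.continuousOn

/-- The fundamental theorem of calculus along the curve. -/
theorem integral_eq_sub {G g : ℂ → ℂ} (hG : ∀ t, HasDerivAt G (g (z t)) (z t))
    (hg : Continuous fun t => g (z t)) :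
    ∫ t in (0 : ℝ)..1, g (z t) * z' t = G (z 1) - G (z 0) := by
  obtain ⟨s, hs, hd⟩ := h.off_countable
  refine integral_eq_of_hasDerivAt_off_countable_of_le (fun t => G (z t)) _ zero_le_one hs ?_ ?_
    (h.integrable_mul hg)
  · exact (continuous_iff_continuousAt.2 fun t =>
      ContinuousAt.comp (hG t).continuousAt h.continuous.continuousAt).continuousOn
  · intro t ht
    exact (hG t).comp t (hd t ht).1

theorem continuous_inv_sub {c : ℂ} (hc : ∀ t, z t ≠ c) : Continuous fun t => (z t - c)⁻¹ :=
  (h.continuous.sub continuous_const).inv₀ fun t => sub_ne_zero.2 (hc t)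

theorem integrable_inv {c : ℂ} (hc : ∀ t, z t ≠ c) :
    IntervalIntegrable (fun t => (z t - c)⁻¹ * z' t) volume 0 1 :=
  h.integrable_mul (h.continuous_inv_sub hc)

theorem continuousOn_log {c : ℂ} (hc : ∀ t, z t ≠ c) :
    ContinuousOn (fun t => ∫ s in (0 : ℝ)..t, (z s - c)⁻¹ * z' s) (Icc 0 1) := by
  have := intervalIntegral.continuousOn_primitive_interval
    (f := fun s => (z s - c)⁻¹ * z' s) (a := 0) (b := 1) (μ := volume) ?_
  · rwa [uIcc_of_le zero_le_one] at this
  · rw [uIcc_of_le zero_le_one]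
    exact (intervalIntegrable_iff_integrableOn_Icc_of_le zero_le_one).1 (h.integrable_inv hc)

/-- With L the integral up to t, exp(-L)·(z - c) is continuous and has zero derivative off a
countable set, so it is constant. This gives a logarithm along the curve without choosing a branch.
-/
theorem exp_log {c : ℂ} (hc : ∀ t, z t ≠ c) {t : ℝ} (ht : t ∈ Icc (0 : ℝ) 1) :
    Complex.exp (∫ s in (0 : ℝ)..t, (z s - c)⁻¹ * z' s) * (z 0 - c) = z t - c := by
  obtain ⟨s, hs, hd⟩ := h.off_countable
  set L : ℝ → ℂ := fun t => ∫ s in (0 : ℝ)..t, (z s - c)⁻¹ * z' s with hL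
  have hsub : Icc 0 t ⊆ Icc (0 : ℝ) 1 := Icc_subset_Icc_right ht.2
  have hcont : ContinuousOn (fun x => Complex.exp (-L x) * (z x - c)) (Icc 0 t) :=
    (((h.continuousOn_log hc).mono hsub).neg.cexp).mul
      (h.continuous.sub continuous_const).continuousOn
  have hder : ∀ x ∈ Ioo 0 t \ s,
      HasDerivAt (fun x => Complex.exp (-L x) * (z x - c)) 0 x := by
    intro x hx
    have hx1 : x ∈ Ioo (0 : ℝ) 1 := ⟨hx.1.1, hx.1.2.trans_le ht.2⟩
    obtain ⟨h1, h2⟩ := hd x ⟨hx1, hx.2⟩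
    have hLd : HasDerivAt L ((z x - c)⁻¹ * z' x) x := by
      refine intervalIntegral.integral_hasDerivAt_right ?_ ?_ ?_
      · refine (h.integrable_inv hc).mono_set ?_
        rw [uIcc_of_le hx1.1.le, uIcc_of_le zero_le_one]
        exact Icc_subset_Icc_right hx1.2.le
      · exact ⟨Ioc 0 1, Ioc_mem_nhds hx1.1 hx1.2, (h.integrable_inv hc).1.aestronglyMeasurable⟩
      · exact ((h.continuous_inv_sub hc).continuousAt).mul h2
    refine ((hLd.neg.cexp).mul (h1.sub_const c)).congr_deriv ?_
    simp only [Pi.neg_apply]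
    linear_combination (-(Complex.exp (-L x) * z' x)) * inv_mul_cancel₀ (sub_ne_zero.2 (hc x))
  have := integral_eq_of_hasDerivAt_off_countable_of_le _ _ ht.1 hs hcont hder (by simp)
  simp only [intervalIntegral.integral_zero] at this
  have h0 : L 0 = 0 := by simp [hL]
  rw [h0, eq_comm, sub_eq_zero, Complex.exp_neg] at this
  simp only [neg_zero, Complex.exp_zero, one_mul] at this
  rw [← this, mul_inv_cancel_left₀ (Complex.exp_ne_zero _)]

theorem exp_integral_inv {c : ℂ} (hc : ∀ t, z t ≠ c) (hz : z 1 = z 0) :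
    Complex.exp (∫ s in (0 : ℝ)..1, (z s - c)⁻¹ * z' s) = 1 := by
  have := h.exp_log hc (t := 1) (by simp)
  rw [hz] at this
  exact mul_right_cancel₀ (sub_ne_zero.2 (hc 0)) (by rw [this, one_mul])

/-- A value in 2πiℤ that equals its own conjugate is 0. -/
theorem integral_inv_of_real {c : ℂ} (hc : ∀ t, z t ≠ c) (hz : z 1 = z 0)
    (hr : ∀ t, (starRingEnd ℂ) (z t - c) = z t - c) (hr' : ∀ t, (starRingEnd ℂ) (z' t) = z' t) :
    ∫ s in (0 : ℝ)..1, (z s - c)⁻¹ * z' s = 0 := by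
  obtain ⟨m, hm⟩ := Complex.exp_eq_one_iff.1 (h.exp_integral_inv hc hz)
  have hcj : (starRingEnd ℂ) (∫ s in (0 : ℝ)..1, (z s - c)⁻¹ * z' s) =
      ∫ s in (0 : ℝ)..1, (z s - c)⁻¹ * z' s := by
    have := Complex.conjCLE.toContinuousLinearMap.intervalIntegral_comp_comm (h.integrable_inv hc)
    simp only [ContinuousLinearEquiv.coe_coe, Complex.conjCLE_apply] at this
    rw [← this]
    simp only [map_mul, map_inv₀, hr, hr']
  rw [Complex.conj_eq_iff_im] at hcj
  rw [hm] at hcj ⊢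
  simp at hcj
  simp [hcj]

/-- The imaginary part of the logarithm and the increment of φ differ by a multiple of 2π at each t.
The difference is continuous, hence constant, and it vanishes at t = 0. The real part of the full
integral is 0 because its exponential is 1. -/
theorem integral_inv_of_angle {c : ℂ} (hc : ∀ t, z t ≠ c) (hz : z 1 = z 0) {φ : ℝ → ℝ}
    (hφ : ContinuousOn φ (Icc 0 1))
    (hp : ∀ t ∈ Icc (0 : ℝ) 1, z t - c = (‖z t - c‖ : ℂ) * Complex.exp (φ t * Complex.I)) :
    ∫ s in (0 : ℝ)..1, (z s - c)⁻¹ * z' s = ((φ 1 - φ 0 : ℝ) : ℂ) * Complex.I := by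
  set L : ℝ → ℂ := fun t => ∫ s in (0 : ℝ)..t, (z s - c)⁻¹ * z' s with hL
  have hcL : ContinuousOn L (Icc 0 1) := h.continuousOn_log hc
  have key : ∀ t ∈ Icc (0 : ℝ) 1, ∃ m : ℤ, (L t).im - (φ t - φ 0) = m * (2 * Real.pi) := by
    intro t ht
    have h1 := h.exp_log hc ht
    have h0 := hp 0 (by simp)
    have ht' := hp t ht
    have hn : ∀ t, (‖z t - c‖ : ℂ) ≠ 0 := fun t => by
      simpa using sub_ne_zero.2 (hc t)
    have hLt : Complex.exp (L t) = Complex.exp (((Real.log ‖z t - c‖ - Real.log ‖z 0 - c‖ : ℝ) : ℂ)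
        + ((φ t - φ 0 : ℝ) : ℂ) * Complex.I) := by
      have hpos : ∀ t, 0 < ‖z t - c‖ := fun t => norm_pos_iff.2 (sub_ne_zero.2 (hc t))
      refine mul_right_cancel₀ (sub_ne_zero.2 (hc 0)) ?_
      rw [h1, Complex.exp_add, ← Complex.ofReal_exp, Real.exp_sub, Real.exp_log (hpos _),
        Real.exp_log (hpos _), h0, ht']
      push_cast
      rw [sub_mul, Complex.exp_sub]
      have e1 := Complex.exp_ne_zero (φ 0 * Complex.I)
      have e2 := hn 0
      simp only [norm_mul, Complex.norm_exp_ofReal_mul_I, Complex.norm_real, norm_norm, mul_one]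
      field_simp
    obtain ⟨m, hm⟩ := Complex.exp_eq_exp_iff_exists_int.1 hLt
    refine ⟨m, ?_⟩
    rw [hm]
    simp
  have hpre : IsPreconnected (Icc (0 : ℝ) 1) := isPreconnected_Icc
  have hpi : (2 * Real.pi) ≠ 0 := by positivity
  have hconst : (L 1).im - (φ 1 - φ 0) = (L 0).im - (φ 0 - φ 0) := by
    have hc1 : ContinuousOn (fun t => ((L t).im - (φ t - φ 0)) / (2 * Real.pi)) (Icc 0 1) :=
      ((Complex.continuous_im.comp_continuousOn hcL).sub (hφ.sub continuousOn_const)).div_const _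
    have := hpre.constant_of_mapsTo isDiscrete_range_intCast hc1 ?_
      (x := 1) (y := 0) (by simp) (by simp)
    · simpa [div_left_inj' hpi] using this
    · intro t ht
      obtain ⟨m, hm⟩ := key t ht
      exact ⟨m, by simp only [hm]; field_simp⟩
  have h0 : L 0 = 0 := by simp [hL]
  have hexp : Complex.exp (L 1) = 1 := h.exp_integral_inv hc hz
  have hre : (L 1).re = 0 := by
    obtain ⟨m, hm⟩ := Complex.exp_eq_one_iff.1 hexp
    rw [hm]; simp
  rw [h0] at hconst
  simp only [Complex.zero_im, sub_self] at hconst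
  apply Complex.ext
  · simpa using hre
  · simpa using sub_eq_zero.1 hconst

/-- The scale r > 0 leaves angles unchanged; it accommodates the factor √(2/n) between the
projection and the character. -/
theorem integral_inv_of_turnsOnceAround {c : ℂ} (hc : ∀ t, z t ≠ c) (hz : z 1 = z 0)
    {r : ℝ} (hr : 0 < r)
    (ht : TurnsOnceAround (fun t : unitInterval => r * z t) (r * c)) :
    ∫ s in (0 : ℝ)..1, (z s - c)⁻¹ * z' s = 2 * Real.pi * Complex.I := by
  obtain ⟨φ, hφ, hp, h2⟩ := ht
  rw [h.integral_inv_of_angle hc hz (φ := fun t => φ (projIcc 0 1 zero_le_one t))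
    (hφ.comp continuous_projIcc).continuousOn]
  · rw [projIcc_right, projIcc_left]
    change ((φ 1 - φ 0 : ℝ) : ℂ) * _ = _
    rw [h2]; push_cast; ring
  · intro t ht
    rw [projIcc_of_mem _ ht]
    have := hp ⟨t, ht⟩
    simp only [← mul_sub, norm_mul, Complex.norm_real, Real.norm_eq_abs, abs_of_pos hr] at this
    push_cast at this
    rw [mul_assoc] at this
    exact mul_left_cancel₀ (by exact_mod_cast hr.ne') this

/-- Dominated convergence: near a point off the curve the kernel is bounded. The hypothesis `hp`
makes the range of z compact although z is defined on all of ℝ. -/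
theorem continuousOn_integral_inv (hp : ∀ t, z t ∈ z '' Icc 0 1) :
    ContinuousOn (fun c => ∫ s in (0 : ℝ)..1, (z s - c)⁻¹ * z' s) (range z)ᶜ := by
  have hK : range z = z '' Icc 0 1 :=
    Subset.antisymm (range_subset_iff.2 hp) (image_subset_range _ _)
  have hcl : IsClosed (range z) := hK ▸ (isCompact_Icc.image h.continuous).isClosed
  intro c hc
  refine ContinuousAt.continuousWithinAt ?_
  have hopen : (range z)ᶜ ∈ 𝓝 c := hcl.isOpen_compl.mem_nhds hc
  obtain ⟨ε, hε, hb⟩ := Metric.mem_nhds_iff.1 hopen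
  refine intervalIntegral.continuousAt_of_dominated_interval
    (bound := fun t => (ε / 2)⁻¹ * ‖z' t‖) ?_ ?_ (h.integrable.norm.const_mul _) ?_
  · filter_upwards [hopen] with d hd
    rw [uIoc_of_le zero_le_one]
    exact (h.integrable_inv (c := d) fun t ht => hd ⟨t, ht⟩).1.aestronglyMeasurable
  · filter_upwards [Metric.ball_mem_nhds c (half_pos hε)] with d hd
    refine Eventually.of_forall fun t _ => ?_
    rw [norm_mul, norm_inv]
    refine mul_le_mul_of_nonneg_right (inv_anti₀ (half_pos hε) ?_) (norm_nonneg _)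
    by_contra! hlt
    have : z t ∈ Metric.ball c ε := by
      rw [Metric.mem_ball] at hd ⊢
      calc dist (z t) c ≤ dist (z t) d + dist d c := dist_triangle _ _ _
        _ < ε / 2 + ε / 2 := add_lt_add (by rwa [dist_eq_norm]) hd
        _ = ε := by ring
    exact hb this ⟨t, rfl⟩
  · refine Eventually.of_forall fun t _ => ?_
    have : z t - c ≠ 0 := sub_ne_zero.2 fun e => hc ⟨t, e⟩
    exact ((continuousAt_const.sub continuousAt_id).inv₀ this).mul continuousAt_const

/-- On the component of c the integral divided by 2πi is a continuous integer, hence constant. An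
unbounded component has points so far from the curve that this integer must be 0. -/
theorem integral_inv_of_unbounded {c : ℂ} (hp : ∀ t, z t ∈ z '' Icc 0 1) (hc : ∀ t, z t ≠ c)
    (hz : z 1 = z 0)
    (hb : ¬ Bornology.IsBounded (connectedComponentIn (range z)ᶜ c)) :
    ∫ s in (0 : ℝ)..1, (z s - c)⁻¹ * z' s = 0 := by
  have hK : range z = z '' Icc 0 1 :=
    Subset.antisymm (range_subset_iff.2 hp) (image_subset_range _ _)
  set V := connectedComponentIn (range z)ᶜ c with hV
  have hcV : c ∈ V := mem_connectedComponentIn fun ⟨t, ht⟩ => hc t ht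
  have hVs : V ⊆ (range z)ᶜ := connectedComponentIn_subset _ _
  set J : ℂ → ℂ := fun c => ∫ s in (0 : ℝ)..1, (z s - c)⁻¹ * z' s with hJ
  have hJint : ∀ d ∈ V, ∃ m : ℤ, J d = m * (2 * Real.pi * Complex.I) := fun d hd =>
    Complex.exp_eq_one_iff.1 (h.exp_integral_inv (fun t e => hVs hd ⟨t, e⟩) hz)
  have hcont : ContinuousOn (fun d => (J d).im / (2 * Real.pi)) V :=
    (Complex.continuous_im.comp_continuousOn
      ((h.continuousOn_integral_inv hp).mono hVs)).div_const _
  have hval : ∀ d ∈ V, (J d).im / (2 * Real.pi) ∈ range ((↑) : ℤ → ℝ) := by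
    intro d hd
    obtain ⟨m, hm⟩ := hJint d hd
    refine ⟨m, ?_⟩
    rw [hm]
    have := Real.pi_ne_zero
    simp
  obtain ⟨R, hR⟩ := (hK ▸ (isCompact_Icc.image h.continuous).isBounded :
    Bornology.IsBounded (range z)).exists_norm_le
  set I := ∫ t in (0 : ℝ)..1, ‖z' t‖ with hI
  have hI0 : 0 ≤ I := intervalIntegral.integral_nonneg zero_le_one fun _ _ => norm_nonneg _
  -- Such a d has distance at least I + 1 from the curve, whence |J d| ≤ I/(I + 1) ≤ 1 < 2π.
  obtain ⟨d, hd, hdn⟩ : ∃ d ∈ V, R + I + 1 < ‖d‖ := by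
    by_contra! hcon
    exact hb (isBounded_iff_forall_norm_le.2 ⟨_, hcon⟩)
  have hJd : ‖J d‖ ≤ 1 := by
    refine (h.norm_integral_mul_le (C := (I + 1)⁻¹) fun t => ?_).trans ?_
    · rw [norm_inv]
      refine inv_anti₀ (by positivity) ?_
      have h1 := hR (z t) ⟨t, rfl⟩
      have h2 := norm_sub_norm_le d (z t)
      rw [norm_sub_rev] at h2
      linarith
    · rw [inv_mul_le_iff₀ (by positivity)]
      linarith
  have hJd0 : (J d).im / (2 * Real.pi) = 0 := by
    obtain ⟨m, hm⟩ := hval d hd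
    have hlt : |(J d).im / (2 * Real.pi)| < 1 := by
      rw [abs_div, abs_of_pos (by positivity : 0 < 2 * Real.pi), div_lt_one (by positivity)]
      have := Real.pi_gt_three
      linarith [Complex.abs_im_le_norm (J d)]
    rw [← hm] at hlt ⊢
    have : |m| < 1 := by exact_mod_cast hlt
    simpa using Int.abs_lt_one_iff.1 this
  have hJc : (J c).im / (2 * Real.pi) = 0 := by
    rw [← hJd0]
    exact isPreconnected_connectedComponentIn.constant_of_mapsTo isDiscrete_range_intCast hcont hval hcV hd
  obtain ⟨m, hm⟩ := hJint c hcV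
  have hpi : (2 * Real.pi) ≠ 0 := by positivity
  rw [hm] at hJc
  change J c = 0
  rw [hm]
  simpa using hJc

end HasPiecewiseDeriv

end

/-! ### Characters of the algebra and discrete Fourier inversion -/

namespace PolarComplex

noncomputable section

/-- The primitive `n`-th root of unity `exp (2πi/n)`. -/
def rootOfUnity (n : ℕ) : ℂ := Complex.exp (2 * Real.pi * Complex.I / n)

theorem isPrimitiveRoot_rootOfUnity (n : ℕ) [NeZero n] : IsPrimitiveRoot (rootOfUnity n) n :=
  Complex.isPrimitiveRoot_exp n (NeZero.ne n)

theorem rootOfUnity_pow_eq (n m : ℕ) :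
    rootOfUnity n ^ m = Complex.exp ((2 * Real.pi * m / n : ℝ) * Complex.I) := by
  rw [rootOfUnity, ← Complex.exp_nat_mul]
  congr 1
  push_cast
  ring

theorem conj_rootOfUnity_pow (n m : ℕ) :
    (starRingEnd ℂ) (rootOfUnity n ^ m) = (rootOfUnity n ^ m)⁻¹ := by
  rw [rootOfUnity_pow_eq, ← Complex.exp_conj, ← Complex.exp_neg, map_mul, Complex.conj_ofReal, Complex.conj_I,
    mul_neg]

theorem rootOfUnity_pow_sub_mul (n : ℕ) [NeZero n] {k : ℕ} (hk : k ≤ n) (p : ℕ) :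
    rootOfUnity n ^ ((n - k) * p) = (rootOfUnity n ^ (k * p))⁻¹ := by
  have h0 : rootOfUnity n ≠ 0 := Complex.exp_ne_zero _
  rw [← one_div, eq_div_iff (pow_ne_zero _ h0), ← pow_add, ← add_mul, Nat.sub_add_cancel hk,
    pow_mul, (isPrimitiveRoot_rootOfUnity n).pow_eq_one, one_pow]

theorem sum_rootOfUnity_pow (n : ℕ) [NeZero n] (m : ℕ) :
    ∑ p : Fin n, rootOfUnity n ^ (m * p) = if n ∣ m then (n : ℂ) else 0 := by
  have hω := isPrimitiveRoot_rootOfUnity n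
  simp only [pow_mul]
  rw [Fin.sum_univ_eq_sum_range (fun p => (rootOfUnity n ^ m) ^ p)]
  split_ifs with h
  · simp [(hω.pow_eq_one_iff_dvd m).2 h]
  · have h1 : rootOfUnity n ^ m ≠ 1 := fun e => h ((hω.pow_eq_one_iff_dvd m).1 e)
    rw [geom_sum_eq h1, ← pow_mul, mul_comm, pow_mul, hω.pow_eq_one]
    simp

theorem rootOfUnity_pow_mul_val_add (n : ℕ) [NeZero n] (k : ℕ) (p q : Fin n) :
    rootOfUnity n ^ (k * ((p + q : Fin n) : ℕ)) =
      rootOfUnity n ^ (k * p) * rootOfUnity n ^ (k * q) := by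
  have hω := isPrimitiveRoot_rootOfUnity n
  rw [← pow_add, ← mul_add, mul_comm k, mul_comm k, pow_mul, pow_mul, Fin.val_add]
  congr 1
  conv_rhs => rw [← Nat.mod_add_div (p + q : ℕ) n, pow_add, pow_mul, hω.pow_eq_one, one_pow, mul_one]

/-- The character `u ↦ ∑_p x_p exp (2πikp/n)`. -/
def character (n k : ℕ) [NeZero n] : PolarComplex n →ₐ[ℝ] ℂ :=
  AlgHom.ofLinearMap
    { toFun := fun u => ∑ p : Fin n, (coord u p : ℂ) * rootOfUnity n ^ (k * p)
      map_add' := fun u v => by simp [coord_add, add_mul, Finset.sum_add_distrib]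
      map_smul' := fun r u => by simp [coord_smul, mul_assoc, Finset.mul_sum] }
    (by simp [coord_one, apply_ite, ite_mul])
    (fun u v => by
      simp only [LinearMap.coe_mk, AddHom.coe_mk, coord_mul, Complex.ofReal_sum,
        Complex.ofReal_mul, Finset.sum_mul]
      rw [Finset.sum_comm]
      refine Finset.sum_congr rfl fun l _ => ?_
      rw [Finset.mul_sum, ← Equiv.sum_comp (Equiv.addRight l)]
      refine Finset.sum_congr rfl fun q _ => ?_
      simp only [Equiv.coe_addRight, add_sub_cancel_right, rootOfUnity_pow_mul_val_add]
      ring)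

theorem character_apply (n k : ℕ) [NeZero n] (u : PolarComplex n) :
    character n k u = ∑ p : Fin n, (coord u p : ℂ) * rootOfUnity n ^ (k * p) := rfl

/-- The character as a continuous real-linear map. -/
def characterCLM (n k : ℕ) [NeZero n] : PolarComplex n →L[ℝ] ℂ :=
  LinearMap.toContinuousLinearMap (character n k).toLinearMap

theorem characterCLM_apply (n k : ℕ) [NeZero n] (u : PolarComplex n) :
    characterCLM n k u = character n k u := rfl

theorem continuous_character (n k : ℕ) [NeZero n] : Continuous (character n k) :=
  (characterCLM n k).continuous

theorem proj_eq (n k : ℕ) [NeZero n] (u : PolarComplex n) :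
    proj k u = (Real.sqrt (2 / n) : ℂ) * character n k u := by
  have h : ∀ p : ℕ, rootOfUnity n ^ (k * p) =
      ⟨Real.cos (2 * Real.pi * k * p / n), Real.sin (2 * Real.pi * k * p / n)⟩ := by
    intro p
    rw [rootOfUnity_pow_eq]
    apply Complex.ext
    · rw [Complex.exp_ofReal_mul_I_re]; push_cast; ring_nf
    · rw [Complex.exp_ofReal_mul_I_im]; push_cast; ring_nf
  apply Complex.ext <;> simp [proj, xi, eta, character_apply, h]

theorem conj_character (n : ℕ) [NeZero n] {k : ℕ} (hk : k ≤ n) (u : PolarComplex n) :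
    (starRingEnd ℂ) (character n k u) = character n (n - k) u := by
  simp only [character_apply, map_sum, map_mul, Complex.conj_ofReal, conj_rootOfUnity_pow]
  refine Finset.sum_congr rfl fun p _ => ?_
  rw [rootOfUnity_pow_sub_mul n hk]

theorem conj_character_of_two_mul (n : ℕ) [NeZero n] {k : ℕ} (hk : k = 0 ∨ 2 * k = n)
    (u : PolarComplex n) : (starRingEnd ℂ) (character n k u) = character n k u := by
  rcases hk with rfl | hk
  · simp [character_apply]
  · rw [conj_character n (by omega)]
    congr 2
    omega

/-- The sine is a difference of the powers ω^{kp} and ω^{(n-k)p}, so two sums over roots of unity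
appear. The first vanishes because 0 < j + k < n; the second survives exactly when n divides j + n -
k, that is, when j = k. -/
theorem character_eTilde (n : ℕ) [NeZero n] {j k : ℕ} (hj : j ≤ n / 2) (hk : 1 ≤ k)
    (hk' : k ≤ (n - 1) / 2) :
    character n j (eTilde n k) = if j = k then Complex.I else 0 := by
  have hn : 0 < n := Nat.pos_of_ne_zero (NeZero.ne n)
  have hsin : ∀ p : ℕ, (Real.sin (2 * Real.pi * k * p / n) : ℂ) =
      (rootOfUnity n ^ (k * p) - rootOfUnity n ^ ((n - k) * p)) / (2 * Complex.I) := by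
    intro p
    rw [rootOfUnity_pow_sub_mul n (by omega), rootOfUnity_pow_eq, ← Complex.exp_neg, Complex.ofReal_sin, Complex.sin]
    have : (((2 * Real.pi * k * p / n : ℝ)) : ℂ) = ((2 * Real.pi * ((k * p : ℕ) : ℝ) / n : ℝ)) := by
      push_cast; ring
    rw [this, neg_mul]
    field_simp
    rw [Complex.I_sq]
    ring
  have hterm : ∀ p : Fin n, (coord (eTilde n k) p : ℂ) * rootOfUnity n ^ (j * p) =
      (rootOfUnity n ^ ((j + k) * p) - rootOfUnity n ^ ((j + (n - k)) * p)) *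
        (2 / n / (2 * Complex.I)) := by
    intro p
    rw [eTilde, coord_ofCoords, Complex.ofReal_mul, hsin p, add_mul, add_mul, pow_add, pow_add]
    push_cast
    ring
  rw [character_apply, Finset.sum_congr rfl fun p _ => hterm p, ← Finset.sum_mul,
    Finset.sum_sub_distrib, sum_rootOfUnity_pow, sum_rootOfUnity_pow,
    if_neg (Nat.not_dvd_of_pos_of_lt (by omega) (by omega))]
  have hn' : (n : ℂ) ≠ 0 := by exact_mod_cast hn.ne'
  split_ifs with h1 h2 h2
  · field_simp
    simp
  · exfalso
    obtain ⟨d, hd⟩ := h1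
    have : d = 1 := by
      have h3 : 0 < d := Nat.pos_of_ne_zero (by rintro rfl; omega)
      have h4 : d < 2 := by
        by_contra! h5
        have := Nat.mul_le_mul_left n h5
        omega
      omega
    subst this
    omega
  · exact absurd ⟨1, by omega⟩ h1
  · simp

theorem eq_zero_of_character_eq_zero (n : ℕ) [NeZero n] {u : PolarComplex n}
    (h : ∀ k ≤ n / 2, character n k u = 0) : u = 0 := by
  have hall : ∀ k < n, character n k u = 0 := by
    intro k hk
    rcases le_or_gt k (n / 2) with h1 | h1
    · exact h k h1
    · rw [← map_eq_zero (starRingEnd ℂ), conj_character n hk.le]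
      exact h _ (by omega)
  apply ext_coord
  intro q
  -- Fourier inversion at q; the exponent n - q replaces -q to stay within natural powers.
  have h0 : ∑ k : Fin n, character n k u * rootOfUnity n ^ (k * (n - q)) = 0 :=
    Finset.sum_eq_zero fun k _ => by rw [hall k k.2, zero_mul]
  simp only [character_apply, Finset.sum_mul] at h0
  rw [Finset.sum_comm] at h0
  have h1 : ∀ p : Fin n, ∑ k : Fin n, (coord u p : ℂ) * rootOfUnity n ^ ((k : ℕ) * p) *
      rootOfUnity n ^ ((k : ℕ) * (n - q)) = if p = q then (coord u p : ℂ) * n else 0 := by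
    intro p
    simp only [mul_assoc, ← pow_add, ← mul_add]
    rw [← Finset.mul_sum]
    simp only [mul_comm _ ((p : ℕ) + (n - q))]
    rw [sum_rootOfUnity_pow]
    have hp := p.2
    have hq := q.2
    split_ifs with h2 h3 h3
    · rfl
    · exfalso
      obtain ⟨d, hd⟩ := h2
      have : d = 1 := by
        have h3 : 0 < d := Nat.pos_of_ne_zero (by rintro rfl; omega)
        have h4 : d < 2 := by
          by_contra! h5
          have := Nat.mul_le_mul_left n h5
          omega
        omega
      subst this
      exact h3 (Fin.ext (by omega))
    · exact absurd ⟨1, by rw [h3]; omega⟩ h2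
    · simp
  rw [Finset.sum_congr rfl fun p _ => h1 p] at h0
  have hn' : (n : ℂ) ≠ 0 := by exact_mod_cast NeZero.ne n
  simp only [Finset.sum_ite_eq', Finset.mem_univ, if_true, mul_eq_zero, hn', or_false] at h0
  exact_mod_cast h0

theorem ext_character (n : ℕ) [NeZero n] {u v : PolarComplex n}
    (h : ∀ k ≤ n / 2, character n k u = character n k v) : u = v :=
  sub_eq_zero.1 (eq_zero_of_character_eq_zero n fun k hk => by rw [map_sub, h k hk, sub_self])

/-- An injective linear map on a finite-dimensional space is bounded below. Estimates and limits may
therefore be checked on characters. -/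
theorem exists_norm_le_sum_character (n : ℕ) [NeZero n] :
    ∃ K : ℝ, 0 < K ∧ ∀ u : PolarComplex n,
      ‖u‖ ≤ K * ∑ k : Fin n, ‖character n k u‖ := by
  obtain ⟨K, hK, h⟩ := (LinearMap.pi fun k : Fin n =>
    (character n k).toLinearMap).exists_antilipschitzWith (by
      rw [LinearMap.ker_eq_bot']
      intro u hu
      have hn : 0 < n := Nat.pos_of_ne_zero (NeZero.ne n)
      refine eq_zero_of_character_eq_zero n fun k hk => ?_
      exact congrFun hu ⟨k, by omega⟩)
  refine ⟨K, hK, fun u => (h.le_mul_norm (by simp) u).trans ?_⟩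
  refine mul_le_mul_of_nonneg_left ?_ K.2
  refine (pi_norm_le_iff_of_nonneg (Finset.sum_nonneg fun _ _ => norm_nonneg _)).2 fun k => ?_
  exact Finset.single_le_sum (f := fun k : Fin n => ‖character n k u‖)
    (fun _ _ => norm_nonneg _) (Finset.mem_univ k)

end

end PolarComplex

/-! ### Integrals of powers and of Laurent expansions along a loop -/

section

open MeasureTheory Set Filter Topology intervalIntegral

namespace PolarComplex

instance (n : ℕ) : CompleteSpace (PolarComplex n) := FiniteDimensional.complete ℝ _

/-- Multiplication as a continuous bilinear map. -/
noncomputable def mulBilin (n : ℕ) [NeZero n] :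
    PolarComplex n →L[ℝ] PolarComplex n →L[ℝ] PolarComplex n :=
  LinearMap.toContinuousLinearMap
    (LinearMap.toContinuousLinearMap.toLinearMap ∘ₗ LinearMap.mul ℝ (PolarComplex n))

section

variable {n : ℕ} [NeZero n]

theorem mulBilin_apply (u v : PolarComplex n) : mulBilin n u v = u * v := rfl

theorem mulCLM_apply (u v : PolarComplex n) : mulCLM u v = u * v := rfl

theorem mulBilin_eq_mulCLM (u : PolarComplex n) : mulBilin n u = mulCLM u := rfl

theorem mulCLM_injective {u v : PolarComplex n} (h : mulCLM u = mulCLM v) : u = v := by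
  simpa [mulCLM_apply] using congrArg (fun L => L (1 : PolarComplex n)) h

theorem norm_mul_le' (u v : PolarComplex n) : ‖u * v‖ ≤ ‖mulBilin n‖ * ‖u‖ * ‖v‖ :=
  (mulBilin n).le_opNorm₂ u v

theorem continuousOn_of_character {X : Type*} [TopologicalSpace X] {g : X → PolarComplex n}
    {s : Set X} (h : ∀ k, ContinuousOn (fun x => character n k (g x)) s) : ContinuousOn g s := by
  obtain ⟨K, -, hK⟩ := exists_norm_le_sum_character n
  intro x hx
  rw [ContinuousWithinAt, tendsto_iff_norm_sub_tendsto_zero]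
  refine squeeze_zero (fun _ => norm_nonneg _) (fun y => hK _) ?_
  have : Tendsto (fun y => K * ∑ k : Fin n, ‖character n k (g y) - character n k (g x)‖) (𝓝[s] x)
      (𝓝 (K * ∑ k : Fin n, 0)) := by
    refine Tendsto.const_mul _ (tendsto_finsetSum _ fun k _ => ?_)
    exact tendsto_iff_norm_sub_tendsto_zero.1 (h k x hx)
  simpa using this

theorem character_inverse (k : ℕ) {u : PolarComplex n} (hu : IsUnit u) :
    character n k (Ring.inverse u) = (character n k u)⁻¹ := by
  refine eq_inv_of_mul_eq_one_left ?_
  rw [← map_mul, Ring.inverse_mul_cancel u hu, map_one]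

theorem character_zpow (k : ℕ) {u : PolarComplex n} (hu : IsUnit u) (j : ℤ) :
    character n k (zpow u j) = character n k u ^ j := by
  cases j with
  | ofNat m => simp [zpow]
  | negSucc m => simp [zpow, character_inverse k hu, zpow_negSucc]

theorem character_ne_zero (k : ℕ) {u : PolarComplex n} (hu : IsUnit u) : character n k u ≠ 0 :=
  (hu.map (character n k)).ne_zero

theorem IsPiecewiseC1.hasPiecewiseDeriv {n : ℕ} {a b : PolarComplex n} {Γ : Path a b}
    (h : IsPiecewiseC1 Γ) : HasPiecewiseDeriv Γ.extend (deriv Γ.extend) := by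
  obtain ⟨m, t, ht, h0, h1, hC⟩ := h
  refine ⟨Γ.continuous_extend, ⟨range t, countable_range t, ?_⟩, ?_⟩
  · rintro x ⟨hx, hxs⟩
    have hex : ∃ i, x < t i := ⟨m, h1 ▸ hx.2⟩
    classical
    -- The first node beyond x is not `t 0 = 0`, so it has a predecessor, and x lies strictly
    -- between the two.
    obtain ⟨i, hi⟩ : ∃ i, Nat.find hex = i + 1 := Nat.exists_eq_succ_of_ne_zero fun h => by
      have := Nat.find_spec hex
      rw [h, h0] at this
      exact lt_asymm this hx.1
    have hm : i < m := by
      have := Nat.find_min' hex (m := m) (h1 ▸ hx.2)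
      omega
    have hxi : x ∈ Ioo (t i) (t (i + 1)) := by
      refine ⟨lt_of_le_of_ne (not_lt.1 (Nat.find_min hex (by omega))) fun e => hxs ⟨i, e⟩, ?_⟩
      rw [← hi]
      exact Nat.find_spec hex
    have hCi := (hC i hm).mono Ioo_subset_Icc_self
    have hnhds := Ioo_mem_nhds hxi.1 hxi.2
    exact ⟨((hCi.differentiableOn one_ne_zero).differentiableAt hnhds).hasDerivAt,
      (hCi.continuousOn_deriv_of_isOpen isOpen_Ioo le_rfl).continuousAt hnhds⟩
  · rw [← h0, ← h1]
    refine IntervalIntegrable.trans_iterate fun i hi => ?_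
    -- The subdivision is only monotone, so a piece may degenerate to a point.
    rcases (ht i.le_succ).eq_or_lt with he | hlt
    · rw [Nat.succ_eq_add_one] at he
      rw [he]
    · have hc := (hC i hi).continuousOn_derivWithin (uniqueDiffOn_Icc hlt) le_rfl
      refine (hc.intervalIntegrable_of_Icc hlt.le).congr_uIoo fun x hx => ?_
      rw [uIoo_of_le hlt.le] at hx
      exact derivWithin_of_mem_nhds (Icc_mem_nhds hx.1 hx.2)

variable {a b : PolarComplex n} {Γ : Path a b} {g : PolarComplex n → PolarComplex n}

theorem pathIntegral_eq (g : PolarComplex n → PolarComplex n) (Γ : Path a b) :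
    pathIntegral g Γ = ∫ t in (0 : ℝ)..1, g (Γ.extend t) * deriv Γ.extend t :=
  curveIntegral_eq_intervalIntegral_deriv _ _

theorem pathIntegrable_iff :
    PathIntegrable g Γ ↔
      IntervalIntegrable (fun t => g (Γ.extend t) * deriv Γ.extend t) volume 0 1 := by
  refine intervalIntegrable_congr_uIoo fun t ht => ?_
  rw [uIoo_of_le zero_le_one] at ht
  rw [curveIntegralFun_def, derivWithin_of_mem_nhds (Icc_mem_nhds ht.1 ht.2)]
  rfl

omit [NeZero n] in
theorem extend_mem_range (Γ : Path a b) (t : ℝ) : Γ.extend t ∈ range Γ :=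
  Γ.extend_range ▸ mem_range_self t

omit [NeZero n] in
theorem isCompact_range_path (Γ : Path a b) : IsCompact (range Γ) :=
  isCompact_range Γ.continuous

theorem pathIntegrable_of_continuousOn (hΓ : IsPiecewiseC1 Γ) (hg : ContinuousOn g (range Γ)) :
    PathIntegrable g Γ := by
  rw [pathIntegrable_iff]
  have hc : Continuous fun t => g (Γ.extend t) :=
    hg.comp_continuous Γ.continuous_extend (extend_mem_range Γ)
  obtain ⟨C, hC⟩ := (isCompact_range_path Γ).exists_bound_of_continuousOn hg
  rw [intervalIntegrable_iff]
  exact (mulBilin n).integrable_of_bilin_of_bdd_left C hc.aestronglyMeasurable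
    (Eventually.of_forall fun t => hC _ (extend_mem_range Γ t))
    (intervalIntegrable_iff.1 hΓ.hasPiecewiseDeriv.integrable)

theorem character_pathIntegral (k : ℕ) (hg : PathIntegrable g Γ) :
    character n k (pathIntegral g Γ) = ∫ t in (0 : ℝ)..1,
      character n k (g (Γ.extend t)) * character n k (deriv Γ.extend t) := by
  rw [pathIntegral_eq, ← characterCLM_apply,
    ← (characterCLM n k).intervalIntegral_comp_comm (pathIntegrable_iff.1 hg)]
  simp only [characterCLM_apply, map_mul]

theorem tendsto_pathIntegral {ι : Type*} {l : Filter ι} [l.NeBot] (hΓ : IsPiecewiseC1 Γ)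
    {G : ι → PolarComplex n → PolarComplex n} (hG : ∀ i, ContinuousOn (G i) (range Γ))
    (h : TendstoUniformlyOn G g l (range Γ)) :
    Tendsto (fun i => pathIntegral (G i) Γ) l (𝓝 (pathIntegral g Γ)) := by
  have hg : ContinuousOn g (range Γ) := h.continuousOn (Frequently.of_forall hG)
  set C := ‖mulBilin n‖ * ∫ t in (0 : ℝ)..1, ‖deriv Γ.extend t‖ with hC
  have hC0 : 0 ≤ C := mul_nonneg (ContinuousLinearMap.opNorm_nonneg _)
    (intervalIntegral.integral_nonneg zero_le_one fun _ _ => norm_nonneg _)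
  rw [Metric.tendsto_nhds]
  intro ε hε
  -- The constant C may be 0, for instance on a constant path.
  have hε' : 0 < ε / (C + 1) := by positivity
  filter_upwards [Metric.tendstoUniformlyOn_iff.1 h _ hε'] with i hi
  rw [dist_eq_norm, pathIntegral_eq, pathIntegral_eq, ← intervalIntegral.integral_sub
    (pathIntegrable_iff.1 (pathIntegrable_of_continuousOn hΓ (hG i)))
    (pathIntegrable_iff.1 (pathIntegrable_of_continuousOn hΓ hg))]
  simp only [← sub_mul]
  calc ‖∫ t in (0 : ℝ)..1, (G i (Γ.extend t) - g (Γ.extend t)) * deriv Γ.extend t‖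
      ≤ ∫ t in (0 : ℝ)..1, (‖mulBilin n‖ * (ε / (C + 1))) * ‖deriv Γ.extend t‖ := by
        refine intervalIntegral.norm_integral_le_of_norm_le zero_le_one
          (Eventually.of_forall fun t _ => ?_)
          (hΓ.hasPiecewiseDeriv.integrable.norm.const_mul _)
        refine (norm_mul_le' _ _).trans (mul_le_mul_of_nonneg_right
          (mul_le_mul_of_nonneg_left ?_ (ContinuousLinearMap.opNorm_nonneg _)) (norm_nonneg _))
        rw [← dist_eq_norm, dist_comm]
        exact (hi _ (extend_mem_range Γ t)).le
    _ = C * (ε / (C + 1)) := by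
        rw [intervalIntegral.integral_const_mul, hC]
        ring
    _ < (C + 1) * (ε / (C + 1)) := by
        exact mul_lt_mul_of_pos_right (by linarith) hε'
    _ = ε := by field_simp

theorem pathIntegral_sum {ι : Type*} (hΓ : IsPiecewiseC1 Γ) (s : Finset ι)
    {G : ι → PolarComplex n → PolarComplex n} (hG : ∀ i, ContinuousOn (G i) (range Γ)) :
    pathIntegral (fun u => ∑ i ∈ s, G i u) Γ = ∑ i ∈ s, pathIntegral (G i) Γ := by
  simp only [pathIntegral_eq, Finset.sum_mul]
  exact intervalIntegral.integral_finsetSum fun i _ =>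
    pathIntegrable_iff.1 (pathIntegrable_of_continuousOn hΓ (hG i))

theorem continuousOn_of_hasSumUniformlyOn {X ι : Type*} [TopologicalSpace X] {s : Set X}
    {G : ι → X → PolarComplex n} {g : X → PolarComplex n} (hG : ∀ i, ContinuousOn (G i) s)
    (h : HasSumUniformlyOn G g s) : ContinuousOn g s :=
  h.tendstoUniformlyOn.continuousOn
    (Frequently.of_forall fun t => continuousOn_finsetSum t fun i _ => hG i)

theorem hasSum_pathIntegral {ι : Type*} (hΓ : IsPiecewiseC1 Γ)
    {G : ι → PolarComplex n → PolarComplex n} (hG : ∀ i, ContinuousOn (G i) (range Γ))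
    (h : HasSumUniformlyOn G g (range Γ)) :
    HasSum (fun i => pathIntegral (G i) Γ) (pathIntegral g Γ) := by
  have := tendsto_pathIntegral hΓ
    (fun s : Finset ι => continuousOn_finsetSum s fun i _ => hG i) h.tendstoUniformlyOn
  simp only [pathIntegral_sum hΓ _ hG] at this
  exact this

theorem continuousOn_mul_zpow {s : Set (PolarComplex n)} {c : PolarComplex n}
    (hc : ∀ u ∈ s, IsUnit (u - c)) (r : PolarComplex n) (j : ℤ) :
    ContinuousOn (fun u => r * zpow (u - c) j) s := by
  refine continuousOn_of_character fun k => ?_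
  have : ContinuousOn (fun u => character n k r * character n k (u - c) ^ j) s := by
    refine continuousOn_const.mul (ContinuousOn.zpow₀ ?_ j fun u hu =>
      Or.inl (character_ne_zero k (hc u hu)))
    exact ((continuous_character n k).comp (continuous_id.sub continuous_const)).continuousOn
  refine this.congr fun u hu => ?_
  simp only [map_mul, character_zpow k (hc u hu)]

/-- On a compact set, a pointwise convergent Laurent expansion converges uniformly. -/
theorem hasSumUniformlyOn_laurent {s : Set (PolarComplex n)} (hs : IsCompact s)
    {c : PolarComplex n} (hc : ∀ u ∈ s, IsUnit (u - c)) {r : ℤ → PolarComplex n}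
    {F : PolarComplex n → PolarComplex n}
    (hF : ∀ u ∈ s, HasSum (fun j : ℤ => r j * zpow (u - c) j) (F u)) :
    HasSumUniformlyOn (fun (j : ℤ) u => r j * zpow (u - c) j) F s := by
  rcases s.eq_empty_or_nonempty with rfl | hne
  · rw [hasSumUniformlyOn_iff_tendstoUniformlyOn]
    exact tendstoUniformlyOn_empty
  have hcont : ∀ k : ℕ, ContinuousOn (fun u => ‖character n k (u - c)‖) s := by
    intro k
    have : Continuous fun u : PolarComplex n => character n k (u - c) :=
      (continuous_character n k).comp (continuous_id.sub continuous_const)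
    exact this.norm.continuousOn
  -- A k and B k maximise and minimise |χ_k(u - c)| on s. The maximum dominates the nonnegative
  -- powers and the minimum, which is positive, the negative ones, so the convergent series at these
  -- two points together majorise every term.
  choose A hA hAmax using fun k => hs.exists_isMaxOn hne (hcont k)
  choose B hB hBmin using fun k => hs.exists_isMinOn hne (hcont k)
  have hsum : ∀ (k : ℕ), ∀ u ∈ s,
      Summable fun j : ℤ => ‖character n k (r j)‖ * ‖character n k (u - c)‖ ^ j := by
    intro k u hu
    have := ((characterCLM n k).summable (hF u hu).summable).norm
    simpa only [characterCLM_apply, map_mul, norm_mul, character_zpow k (hc u hu), norm_zpow]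
      using this
  obtain ⟨K, hK0, hK⟩ := exists_norm_le_sum_character n
  have hsummable : Summable fun j : ℤ => K * ∑ k : Fin n,
      (‖character n k (r j)‖ * ‖character n k (A k - c)‖ ^ j +
        ‖character n k (r j)‖ * ‖character n k (B k - c)‖ ^ j) := by
    refine Summable.mul_left K (summable_sum fun k _ => ?_)
    exact (hsum k _ (hA k)).add (hsum k _ (hB k))
  have hbound : ∀ (j : ℤ), ∀ u ∈ s, ‖r j * zpow (u - c) j‖ ≤ K * ∑ k : Fin n,
      (‖character n k (r j)‖ * ‖character n k (A k - c)‖ ^ j +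
        ‖character n k (r j)‖ * ‖character n k (B k - c)‖ ^ j) := by
    intro j u hu
    refine (hK _).trans (mul_le_mul_of_nonneg_left (Finset.sum_le_sum fun k _ => ?_) hK0.le)
    rw [map_mul, norm_mul, character_zpow k (hc u hu), norm_zpow, ← mul_add]
    refine mul_le_mul_of_nonneg_left ?_ (norm_nonneg _)
    have hmax : ‖character n k (u - c)‖ ≤ ‖character n k (A k - c)‖ := hAmax k hu
    have hmin : ‖character n k (B k - c)‖ ≤ ‖character n k (u - c)‖ := hBmin k hu
    have hpos : 0 < ‖character n k (B k - c)‖ := norm_pos_iff.2 (character_ne_zero k (hc _ (hB k)))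
    rcases le_total 0 j with hj | hj
    · exact (zpow_le_zpow_left₀ hj (norm_nonneg _) hmax).trans
        (le_add_of_nonneg_right (zpow_nonneg hpos.le _))
    · refine le_trans ?_ (le_add_of_nonneg_left (zpow_nonneg (norm_nonneg _) _))
      obtain ⟨i, rfl⟩ := Int.exists_eq_neg_ofNat hj
      simp only [zpow_neg, zpow_natCast]
      exact inv_anti₀ (pow_pos hpos _) (pow_le_pow_left₀ hpos.le hmin _)
  exact (HasSumUniformlyOn.of_norm_le_summable hsummable hbound).congr_right
    fun u hu => (hF u hu).tsum_eq

theorem character_intSum {k : ℕ} (hk : k ≤ n / 2) (c : PolarComplex n) (Γ : Path a b) :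
    character n k (intSum c Γ) = if k ∈ Finset.Icc 1 ((n - 1) / 2) then
      (interiorIndicator (proj k c) (projPath k Γ) : ℂ) * Complex.I else 0 := by
  rw [intSum, map_sum]
  have : ∀ j ∈ Finset.Icc 1 ((n - 1) / 2), character n k
      (interiorIndicator (proj j c) (projPath j Γ) • eTilde n j) = if k = j then
        (interiorIndicator (proj j c) (projPath j Γ) : ℂ) * Complex.I else 0 := by
    intro j hj
    rw [Finset.mem_Icc] at hj
    rw [map_smul, character_eTilde n hk hj.1 hj.2]
    split_ifs <;> simp
  rw [Finset.sum_congr rfl this, Finset.sum_ite_eq]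

theorem integral_inv_character {Γ : Path a a} (hΓ : IsPiecewiseC1 Γ)
    (hor : ∀ k ∈ Finset.Icc 1 ((n - 1) / 2), IsPositivelyOriented (projPath k Γ))
    {c : PolarComplex n} (hc : ∀ u ∈ range Γ, IsUnit (u - c)) {k : ℕ} (hk : k ≤ n / 2) :
    ∫ t in (0 : ℝ)..1, (character n k (Γ.extend t) - character n k c)⁻¹ *
      character n k (deriv Γ.extend t) = 2 * Real.pi * character n k (intSum c Γ) := by
  have hz := hΓ.hasPiecewiseDeriv.clm_comp (characterCLM n k)
  simp only [characterCLM_apply] at hz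
  have hne : ∀ t, character n k (Γ.extend t) ≠ character n k c := fun t => by
    rw [← sub_ne_zero, ← map_sub]
    exact character_ne_zero k (hc _ (extend_mem_range Γ t))
  have hclosed : character n k (Γ.extend 1) = character n k (Γ.extend 0) := by simp
  rw [character_intSum hk]
  split_ifs with hmem
  · have hn : 0 < n := Nat.pos_of_ne_zero (NeZero.ne n)
    have hr : 0 < Real.sqrt (2 / n) := Real.sqrt_pos.2 (by positivity)
    have hr' : (Real.sqrt (2 / n) : ℂ) ≠ 0 := by exact_mod_cast hr.ne'
    have hcurve : projPath k Γ = fun t : unitInterval =>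
        (Real.sqrt (2 / n) : ℂ) * character n k (Γ.extend t) := by
      funext t
      rw [projPath, proj_eq, Path.extend_apply Γ t.2]
    have hrange : range (projPath k Γ) =
        (fun z => (Real.sqrt (2 / n) : ℂ) * z) '' range fun t => character n k (Γ.extend t) := by
      have : range (fun t => character n k (Γ.extend t)) = character n k '' range Γ := by
        rw [← Γ.extend_range, ← range_comp]; rfl
      rw [this, ← range_comp, ← range_comp]
      refine congrArg range (funext fun t => ?_)
      exact proj_eq n k (Γ t)
    have hout : proj k c ∉ range (projPath k Γ) := by
      rw [hrange, proj_eq]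
      rintro ⟨_, ⟨t, rfl⟩, ht⟩
      exact hne t (mul_left_cancel₀ hr' ht)
    by_cases hint : IsInteriorPoint (proj k c) (projPath k Γ)
    · have hturn := hor k hmem _ hint
      rw [hcurve, proj_eq] at hturn
      rw [hz.integral_inv_of_turnsOnceAround hne hclosed hr hturn, interiorIndicator, if_pos hint]
      push_cast
      ring
    · rw [hz.integral_inv_of_unbounded _ hne hclosed, interiorIndicator, if_neg hint]
      · simp
      · intro hb
        refine hint ⟨hout, ?_⟩
        -- The homothety by √(2/n) carries the component for the character curve onto that for the
        -- projection and preserves boundedness.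
        let e : ℂ ≃ₜ ℂ := Homeomorph.mulLeft₀ (Real.sqrt (2 / n) : ℂ) hr'
        have he : ∀ z, e z = (Real.sqrt (2 / n) : ℂ) * z := fun _ => rfl
        have himg : e '' connectedComponentIn (range fun t => character n k (Γ.extend t))ᶜ
            (character n k c) = connectedComponentIn (range (projPath k Γ))ᶜ (proj k c) := by
          rw [e.image_connectedComponentIn, image_compl_eq e.bijective, hrange, proj_eq]
          · rfl
          · rintro ⟨t, ht⟩
            exact hne t ht
        rw [← himg]
        exact ((ContinuousLinearMap.mul ℝ ℂ (Real.sqrt (2 / n) : ℂ)).lipschitz).isBounded_image hb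
      · intro t
        obtain ⟨s, hs⟩ := extend_mem_range Γ t
        exact ⟨s, s.2, by rw [← hs]; simp⟩
  · have hk' : k = 0 ∨ 2 * k = n := by
      rw [Finset.mem_Icc] at hmem
      omega
    rw [hz.integral_inv_of_real hne hclosed, mul_zero]
    · intro t
      rw [← map_sub, conj_character_of_two_mul n hk']
    · intro t
      exact conj_character_of_two_mul n hk' _

/-- Checked on each character: for j ≠ -1 the integrand has the primitive (z - χ_k(c))^{j+1}/(j + 1)
and the curve is closed; for j = -1 it is the logarithmic integral. -/
theorem pathIntegral_mul_zpow {Γ : Path a a} (hΓ : IsPiecewiseC1 Γ)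
    (hor : ∀ k ∈ Finset.Icc 1 ((n - 1) / 2), IsPositivelyOriented (projPath k Γ))
    {c : PolarComplex n} (hc : ∀ u ∈ range Γ, IsUnit (u - c)) (r : PolarComplex n) (j : ℤ) :
    pathIntegral (fun u => r * zpow (u - c) j) Γ =
      if j = -1 then (2 * Real.pi) • (intSum c Γ * r) else 0 := by
  refine ext_character n fun k hk => ?_
  rw [character_pathIntegral k
    (pathIntegrable_of_continuousOn hΓ (continuousOn_mul_zpow hc r j))]
  simp only [map_mul, character_zpow k (hc _ (extend_mem_range Γ _)), mul_assoc, map_sub]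
  rw [intervalIntegral.integral_const_mul]
  have hne : ∀ t, character n k (Γ.extend t) - character n k c ≠ 0 := fun t => by
    rw [← map_sub]
    exact character_ne_zero k (hc _ (extend_mem_range Γ t))
  split_ifs with hj
  · subst hj
    simp only [zpow_neg_one]
    rw [integral_inv_character hΓ hor hc hk, map_smul, map_mul, Complex.real_smul]
    push_cast
    ring
  · have hz := hΓ.hasPiecewiseDeriv.clm_comp (characterCLM n k)
    simp only [characterCLM_apply] at hz
    have hj' : ((j + 1 : ℤ) : ℂ) ≠ 0 := by
      exact_mod_cast fun h : j + 1 = 0 => hj (by omega)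
    rw [hz.integral_eq_sub (g := fun z => (z - character n k c) ^ j)
      (G := fun z => (z - character n k c) ^ (j + 1) / ((j + 1 : ℤ) : ℂ))]
    · simp
    · intro t
      have h1 := ((hasDerivAt_zpow (j + 1) _ (Or.inl (hne t))).comp
        (character n k (Γ.extend t)) ((hasDerivAt_id _).sub_const _)).div_const ((j + 1 : ℤ) : ℂ)
      refine h1.congr_deriv ?_
      rw [add_sub_cancel_right, mul_one, mul_div_cancel_left₀ _ hj']
    · exact (hz.continuous.sub continuous_const).zpow₀ j fun t => Or.inl (hne t)

theorem pathIntegral_laurent {Γ : Path a a} (hΓ : IsPiecewiseC1 Γ)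
    (hor : ∀ k ∈ Finset.Icc 1 ((n - 1) / 2), IsPositivelyOriented (projPath k Γ))
    {c : PolarComplex n} (hc : ∀ u ∈ range Γ, IsUnit (u - c)) {r : ℤ → PolarComplex n}
    {F : PolarComplex n → PolarComplex n}
    (hF : ∀ u ∈ range Γ, HasSum (fun j : ℤ => r j * zpow (u - c) j) (F u)) :
    ContinuousOn F (range Γ) ∧ pathIntegral F Γ = (2 * Real.pi) • (intSum c Γ * r (-1)) := by
  have hcont := fun j => continuousOn_mul_zpow hc (r j) j
  have hu := hasSumUniformlyOn_laurent (isCompact_range_path Γ) hc hF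
  refine ⟨continuousOn_of_hasSumUniformlyOn hcont hu, ?_⟩
  have h := hasSum_pathIntegral hΓ hcont hu
  simp only [pathIntegral_mul_zpow hΓ hor hc] at h
  refine h.unique ?_
  convert hasSum_single (-1 : ℤ) ?_ using 1
  · simp
  · intro j hj
    rw [if_neg hj]

end

end PolarComplex

/-! ### Termwise differentiation of power series -/

namespace PolarComplex

section

variable {n : ℕ} [NeZero n]

theorem HasPolarDerivAt.polarDeriv_eq {f : PolarComplex n → PolarComplex n}
    {f' u : PolarComplex n} (h : HasPolarDerivAt f f' u) : polarDeriv f u = f' := by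
  have hex : ∃ f', HasPolarDerivAt f f' u := ⟨f', h⟩
  rw [polarDeriv, dif_pos hex]
  exact mulCLM_injective (HasFDerivAt.unique hex.choose_spec h)

theorem HasPolarDerivAt.mul {f g : PolarComplex n → PolarComplex n} {f' g' u : PolarComplex n}
    (hf : HasPolarDerivAt f f' u) (hg : HasPolarDerivAt g g' u) :
    HasPolarDerivAt (fun v => f v * g v) (f u * g' + f' * g u) u := by
  refine ((mulBilin n).hasFDerivAt_of_bilinear hf hg).congr_fderiv ?_
  ext1 v
  change f u * (g' * v) + (f' * v) * g u = (f u * g' + f' * g u) * v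
  ring

theorem hasPolarDerivAt_const (c u : PolarComplex n) : HasPolarDerivAt (fun _ => c) 0 u := by
  refine (hasFDerivAt_const c u).congr_fderiv ?_
  ext1 v
  exact (zero_mul v).symm

theorem hasPolarDerivAt_sub_const (c u : PolarComplex n) :
    HasPolarDerivAt (fun v => v - c) 1 u := by
  refine ((hasFDerivAt_id u).sub_const c).congr_fderiv ?_
  ext1 v
  exact (one_mul v).symm

theorem hasPolarDerivAt_sub_pow (c u : PolarComplex n) (j : ℕ) :
    HasPolarDerivAt (fun v => (v - c) ^ j) ((j : PolarComplex n) * (u - c) ^ (j - 1)) u := by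
  induction j with
  | zero => simpa using hasPolarDerivAt_const 1 u
  | succ j ih =>
    have h := ih.mul (hasPolarDerivAt_sub_const c u)
    simp only [← pow_succ] at h
    convert h using 1
    rcases j with _ | j
    · simp
    · push_cast
      ring

theorem hasPolarDerivAt_mul_sub_pow (a c u : PolarComplex n) (j : ℕ) :
    HasPolarDerivAt (fun v => a * (v - c) ^ j) (a * ((j : PolarComplex n) * (u - c) ^ (j - 1))) u := by
  simpa using (hasPolarDerivAt_const a u).mul (hasPolarDerivAt_sub_pow c u j)

theorem norm_mul_pow_le {B : ℝ} (hB : ‖mulBilin n‖ ≤ B) (c u : PolarComplex n) (j : ℕ) :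
    ‖c * u ^ j‖ ≤ ‖c‖ * (B * ‖u‖) ^ j := by
  have hB0 : 0 ≤ B := (ContinuousLinearMap.opNorm_nonneg _).trans hB
  induction j with
  | zero => simp
  | succ j ih =>
    calc ‖c * u ^ (j + 1)‖ = ‖(c * u ^ j) * u‖ := by rw [pow_succ, mul_assoc]
      _ ≤ ‖mulBilin n‖ * ‖c * u ^ j‖ * ‖u‖ := norm_mul_le' _ _
      _ ≤ B * (‖c‖ * (B * ‖u‖) ^ j) * ‖u‖ := by gcongr
      _ = ‖c‖ * (B * ‖u‖) ^ (j + 1) := by ring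

/-- Evaluation at the real displacement r·1 gives the terms r^j c_j, whose norms are exactly r^j
‖c_j‖ and tend to 0. -/
theorem exists_coeff_bound {u₀ : PolarComplex n} {c : ℕ → PolarComplex n}
    (h : ∀ᶠ u in 𝓝 u₀, Summable fun j => c j * (u - u₀) ^ j) :
    ∃ r > 0, ∃ M, 0 ≤ M ∧ ∀ j, ‖c j‖ * r ^ j ≤ M := by
  have ht : Tendsto (fun t : ℝ => u₀ + t • (1 : PolarComplex n)) (𝓝[>] 0) (𝓝 u₀) := by
    have : Continuous fun t : ℝ => u₀ + t • (1 : PolarComplex n) := by fun_prop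
    simpa using (this.tendsto 0).mono_left nhdsWithin_le_nhds
  obtain ⟨r, hr, hr0⟩ := ((ht.eventually h).and self_mem_nhdsWithin).exists
  obtain ⟨M, hM⟩ := hr.tendsto_atTop_zero.norm.bddAbove_range
  refine ⟨r, hr0, M, (norm_nonneg _).trans (hM ⟨0, rfl⟩), fun j => ?_⟩
  have := hM ⟨j, rfl⟩
  simp only [add_sub_cancel_left, smul_pow, one_pow, mul_smul_comm, mul_one, norm_smul, norm_pow,
    Real.norm_eq_abs, abs_of_pos (show 0 < r from hr0)] at this
  rwa [mul_comm]

/-- The modulus is submultiplicative only up to the factor B, so |c u^j| ≤ |c| (B|u|)^j. The radius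
r/(2B) makes B|u - u₀| ≤ r/2, which gains a factor 2^{-j} over the bound M. -/
theorem norm_mulBilin_deriv_term_le {B r M : ℝ} (hB : ‖mulBilin n‖ ≤ B) (hB0 : 0 < B) (hr : 0 < r)
    {c : ℕ → PolarComplex n} (hM : ∀ j, ‖c j‖ * r ^ j ≤ M) (j : ℕ) {u₀ u : PolarComplex n}
    (hu : u ∈ Metric.ball u₀ (r / (2 * B))) :
    ‖mulBilin n (c j * ((j : PolarComplex n) * (u - u₀) ^ (j - 1)))‖ ≤
      (2 * B * M / r) * ((j : ℝ) ^ 1 * (1 / 2) ^ j) := by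
  rcases j with _ | j
  · simp
  · have hu' : B * ‖u - u₀‖ ≤ r / 2 := by
      rw [mem_ball_iff_norm, lt_div_iff₀ (by positivity)] at hu
      linarith
    have e : c (j + 1) * (((j + 1 : ℕ) : PolarComplex n) * (u - u₀) ^ (j + 1 - 1)) =
        (j + 1 : ℝ) • (c (j + 1) * (u - u₀) ^ j) := by
      rw [Nat.add_sub_cancel, Algebra.smul_def]
      simp only [map_add, map_natCast, map_one]
      push_cast
      ring
    calc ‖mulBilin n (c (j + 1) * (((j + 1 : ℕ) : PolarComplex n) * (u - u₀) ^ (j + 1 - 1)))‖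
        ≤ ‖mulBilin n‖ * ‖(j + 1 : ℝ) • (c (j + 1) * (u - u₀) ^ j)‖ := by
          rw [e]; exact (mulBilin n).le_opNorm _
      _ = ‖mulBilin n‖ * ((j + 1) * ‖c (j + 1) * (u - u₀) ^ j‖) := by
          rw [norm_smul, Real.norm_of_nonneg (by positivity)]
      _ ≤ B * ((j + 1) * (‖c (j + 1)‖ * (r / 2) ^ j)) := by
          have h1 : ‖c (j + 1) * (u - u₀) ^ j‖ ≤ ‖c (j + 1)‖ * (r / 2) ^ j :=
            (norm_mul_pow_le hB _ _ j).trans (mul_le_mul_of_nonneg_left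
              (pow_le_pow_left₀ (by positivity) hu' _) (norm_nonneg _))
          gcongr
      _ = (2 * B * (‖c (j + 1)‖ * r ^ (j + 1)) / r) *
            (((j + 1 : ℕ) : ℝ) ^ 1 * (1 / 2) ^ (j + 1)) := by
          push_cast
          rw [div_pow, div_pow, one_pow]
          field_simp
          ring
      _ ≤ _ := by
          have := hM (j + 1)
          gcongr

/-- A convergent power series is differentiable term by term near its centre. -/
theorem eventually_hasPolarDerivAt {u₀ : PolarComplex n} {c : ℕ → PolarComplex n}
    {g : PolarComplex n → PolarComplex n}
    (h : ∀ᶠ u in 𝓝 u₀, HasSum (fun j => c j * (u - u₀) ^ j) (g u)) :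
    ∀ᶠ u in 𝓝 u₀, ∃ g', HasPolarDerivAt g g' u ∧
      HasSum (fun j => (((j + 1 : ℕ) : PolarComplex n) * c (j + 1)) * (u - u₀) ^ j) g' := by
  obtain ⟨r, hr, M, hM0, hM⟩ := exists_coeff_bound (h.mono fun u hu => hu.summable)
  set B := ‖mulBilin n‖ + 1 with hB
  have hB1 : ‖mulBilin n‖ ≤ B := by linarith
  have hB0 : 0 < B := by
    have := ContinuousLinearMap.opNorm_nonneg (mulBilin n)
    linarith
  have hρ : 0 < r / (2 * B) := by positivity
  have hbound : ∀ (j : ℕ), ∀ u ∈ Metric.ball u₀ (r / (2 * B)),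
      ‖mulBilin n (c j * ((j : PolarComplex n) * (u - u₀) ^ (j - 1)))‖ ≤
        (2 * B * M / r) * ((j : ℝ) ^ 1 * (1 / 2) ^ j) :=
    fun j u hu => norm_mulBilin_deriv_term_le hB1 hB0 hr hM j hu
  have hsumm : Summable fun j : ℕ => (2 * B * M / r) * ((j : ℝ) ^ 1 * (1 / 2) ^ j) := by
    have h2 : ‖(1 / 2 : ℝ)‖ < 1 := by norm_num
    exact Summable.mul_left _ (summable_pow_mul_geometric_of_norm_lt_one 1 h2)
  have h0 : Summable fun j => c j * (u₀ - u₀) ^ j := h.self_of_nhds.summable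
  have hd : ∀ (j : ℕ), ∀ v ∈ Metric.ball u₀ (r / (2 * B)),
      HasFDerivAt (fun v => c j * (v - u₀) ^ j)
        (mulBilin n (c j * ((j : PolarComplex n) * (v - u₀) ^ (j - 1)))) v := by
    intro j v _
    rw [mulBilin_eq_mulCLM]
    exact hasPolarDerivAt_mul_sub_pow (c j) u₀ v j
  have hconn : IsPreconnected (Metric.ball u₀ (r / (2 * B))) := (convex_ball u₀ _).isPreconnected
  filter_upwards [Metric.ball_mem_nhds u₀ hρ, h.eventually_nhds] with u hu hgu
  have hder := hasFDerivAt_tsum_of_isPreconnected hsumm Metric.isOpen_ball hconn hd hbound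
    (Metric.mem_ball_self hρ) h0 hu
  have hS : Summable fun j => mulBilin n (c j * ((j : PolarComplex n) * (u - u₀) ^ (j - 1))) :=
    Summable.of_norm_bounded hsumm fun j => hbound j u hu
  have hS' : Summable fun j => c j * ((j : PolarComplex n) * (u - u₀) ^ (j - 1)) := by
    have := (ContinuousLinearMap.apply ℝ (PolarComplex n) (1 : PolarComplex n)).summable hS
    simpa [mulBilin_apply] using this
  refine ⟨∑' j, c j * ((j : PolarComplex n) * (u - u₀) ^ (j - 1)), ?_, ?_⟩
  · rw [← (mulBilin n).map_tsum hS', mulBilin_eq_mulCLM] at hder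
    exact hder.congr_of_eventuallyEq (hgu.mono fun v hv => hv.tsum_eq.symm)
  · have := (hasSum_nat_add_iff' 1).2 hS'.hasSum
    simp only [Finset.range_one, Finset.sum_singleton, Nat.cast_zero, zero_mul, mul_zero,
      sub_zero, Nat.add_sub_cancel] at this
    refine this.congr_fun ?_
    intro j
    ring

/-- Each differentiation shifts the coefficients by one; after m of them the accumulated factor is
(j+1)(j+2)⋯(j+m). -/
theorem eventually_hasSum_iteratedPolarDeriv {u₀ : PolarComplex n} {c : ℕ → PolarComplex n}
    {f : PolarComplex n → PolarComplex n}
    (h : ∀ᶠ u in 𝓝 u₀, HasSum (fun j => c j * (u - u₀) ^ j) (f u)) (m : ℕ) :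
    ∀ᶠ u in 𝓝 u₀, HasSum
      (fun j => (((j + 1).ascFactorial m : ℕ) * c (j + m)) * (u - u₀) ^ j)
      (iteratedPolarDeriv m f u) := by
  induction m with
  | zero => simpa [iteratedPolarDeriv] using h
  | succ m ih =>
    filter_upwards [eventually_hasPolarDerivAt ih] with u hu
    obtain ⟨g', hd, hs⟩ := hu
    rw [iteratedPolarDeriv, Function.iterate_succ_apply', ← iteratedPolarDeriv, hd.polarDeriv_eq]
    convert hs using 3 with j
    rw [← mul_assoc, ← Nat.cast_mul, Nat.ascFactorial_succ, ← Nat.succ_ascFactorial,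
      add_right_comm j 1 m, add_assoc j m 1]

theorem eventually_hasPolarDerivAt_iteratedPolarDeriv {u₀ : PolarComplex n}
    {c : ℕ → PolarComplex n} {f : PolarComplex n → PolarComplex n}
    (h : ∀ᶠ u in 𝓝 u₀, HasSum (fun j => c j * (u - u₀) ^ j) (f u)) (m : ℕ) :
    ∀ᶠ u in 𝓝 u₀, HasPolarDerivAt (iteratedPolarDeriv m f) (iteratedPolarDeriv (m + 1) f u) u := by
  filter_upwards [eventually_hasPolarDerivAt (eventually_hasSum_iteratedPolarDeriv h m)]
    with u ⟨g', hd, _⟩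
  have h1 : iteratedPolarDeriv (m + 1) f u = g' := by
    rw [iteratedPolarDeriv, Function.iterate_succ_apply', ← iteratedPolarDeriv, hd.polarDeriv_eq]
  rwa [h1]

theorem iteratedPolarDeriv_center {u₀ : PolarComplex n}
    {c : ℕ → PolarComplex n} {f : PolarComplex n → PolarComplex n}
    (h : ∀ᶠ u in 𝓝 u₀, HasSum (fun j => c j * (u - u₀) ^ j) (f u)) (m : ℕ) :
    iteratedPolarDeriv m f u₀ = (m.factorial : ℝ) • c m := by
  have := (eventually_hasSum_iteratedPolarDeriv h m).self_of_nhds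
  refine this.unique ?_
  convert hasSum_single 0 ?_ using 1
  · rw [Algebra.smul_def]
    simp [Nat.one_ascFactorial]
  · intro j hj
    simp [hj]

/-- Division of a power series by `(u - u₀) ^ (m + 1)` gives a Laurent series. -/
theorem hasSum_mul_inverse_pow {u u₀ : PolarComplex n} (hu : IsUnit (u - u₀))
    {c : ℕ → PolarComplex n} {x : PolarComplex n}
    (h : HasSum (fun j => c j * (u - u₀) ^ j) x) (m : ℕ) :
    HasSum (fun j : ℤ => (if 0 ≤ j + (m + 1) then c (j + (m + 1)).toNat else 0) *
      zpow (u - u₀) j) (x * Ring.inverse (u - u₀) ^ (m + 1)) := by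
  have hinj : Function.Injective fun j : ℕ => (j : ℤ) - (m + 1) := fun i j hij => by
    simpa using hij
  -- The power series is reindexed by j ↦ j - (m + 1); the coefficients outside the image are zero.
  rw [← hinj.hasSum_iff]
  · have h1 := (mulBilin n (Ring.inverse (u - u₀) ^ (m + 1))).hasSum h
    rw [mulBilin_apply, mul_comm] at h1
    refine h1.congr_fun ?_
    intro j
    simp only [Function.comp_apply, sub_add_cancel, Int.natCast_nonneg, if_true, Int.toNat_natCast,
      mulBilin_apply]
    refine ext_character n fun k _ => ?_
    have hne := character_ne_zero k hu
    simp only [map_mul, map_pow, character_zpow k hu, character_inverse k hu]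
    rw [zpow_sub₀ hne, zpow_natCast]
    rw [← Nat.cast_succ, zpow_natCast, inv_pow, Nat.succ_eq_add_one]
    ring
  · intro j hj
    rw [if_neg, zero_mul]
    intro hj0
    exact hj ⟨(j + (m + 1)).toNat, by simp only [Int.toNat_of_nonneg hj0]; ring⟩

end

end PolarComplex

end

/-! ### The three integral formulas -/

open PolarComplex in
theorem mainTheorem8 (n : ℕ) [NeZero n] (a : PolarComplex n) (Γ : Path a a)
    (hΓ : IsPiecewiseC1 Γ)
    (hor : ∀ k ∈ Finset.Icc 1 ((n - 1) / 2), IsPositivelyOriented (projPath k Γ)) :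
    -- the integral of `du / (u - u₀)`
    (∀ u₀ : PolarComplex n, (∀ t, IsUnit (Γ t - u₀)) →
      PathIntegrable (fun u => Ring.inverse (u - u₀)) Γ ∧
      pathIntegral (fun u => Ring.inverse (u - u₀)) Γ =
        ∑ k ∈ Finset.Icc 1 ((n - 1) / 2),
          (2 * Real.pi * interiorIndicator (proj k u₀) (projPath k Γ)) • eTilde n k) ∧
    -- the integrals of `f(u) du / (u - u₀)` and `f(u) du / (u - u₀)^(m+1)`
    (∀ u₀ : PolarComplex n, (∀ t, IsUnit (Γ t - u₀)) →
      ∀ (f : PolarComplex n → PolarComplex n) (c : ℕ → PolarComplex n) (S : Set (PolarComplex n)),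
        Set.range Γ ⊆ S → S ∈ nhds u₀ →
        (∀ u ∈ S, HasSum (fun j => c j * (u - u₀) ^ j) (f u)) →
        (PathIntegrable (fun u => f u * Ring.inverse (u - u₀)) Γ ∧
          pathIntegral (fun u => f u * Ring.inverse (u - u₀)) Γ =
            (2 * Real.pi) • (f u₀ * intSum u₀ Γ)) ∧
        (∀ m : ℕ,
          (∀ᶠ u in nhds u₀, HasPolarDerivAt (iteratedPolarDeriv m f)
            (iteratedPolarDeriv (m + 1) f u) u) ∧
          PathIntegrable (fun u => f u * Ring.inverse (u - u₀) ^ (m + 1)) Γ ∧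
          pathIntegral (fun u => f u * Ring.inverse (u - u₀) ^ (m + 1)) Γ =
            (2 * Real.pi / (m.factorial : ℝ)) • (iteratedPolarDeriv m f u₀ * intSum u₀ Γ))) ∧
    -- `f` is a sum of expansions in positive and negative powers of `u - u_l`
    (∀ (ι : Type*) (c : ι → PolarComplex n) (r : ι → ℤ → PolarComplex n)
        (F : ι → PolarComplex n → PolarComplex n) (f : PolarComplex n → PolarComplex n),
      (∀ l t, IsUnit (Γ t - c l)) →
      (∀ l, ∀ u ∈ Set.range Γ, HasSum (fun j : ℤ => r l j * zpow (u - c l) j) (F l u)) →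
      HasSumUniformlyOn F f (Set.range Γ) →
      PathIntegrable f Γ ∧
      HasSum (fun l => (2 * Real.pi) • (intSum (c l) Γ * r l (-1))) (pathIntegral f Γ)) := by
  have hunit : ∀ {u₀ : PolarComplex n}, (∀ t, IsUnit (Γ t - u₀)) →
      ∀ u ∈ Set.range Γ, IsUnit (u - u₀) := by
    rintro u₀ h _ ⟨t, rfl⟩
    exact h t
  refine ⟨fun u₀ hu => ?_, fun u₀ hu f c S hΓS hS hf => ?_, fun ι c r F f hu hF hf => ?_⟩
  · have heq : (fun u => Ring.inverse (u - u₀)) =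
        fun u : PolarComplex n => 1 * zpow (u - u₀) (-1) := by
      funext u
      rw [one_mul]
      exact (pow_one _).symm
    rw [heq]
    refine ⟨pathIntegrable_of_continuousOn hΓ (continuousOn_mul_zpow (hunit hu) _ _), ?_⟩
    rw [pathIntegral_mul_zpow hΓ hor (hunit hu), if_pos rfl, mul_one, intSum, Finset.smul_sum]
    simp only [smul_smul]
  · have hnear : ∀ᶠ u in nhds u₀, HasSum (fun j => c j * (u - u₀) ^ j) (f u) :=
      Filter.mem_of_superset hS hf
    have key : ∀ m : ℕ, PathIntegrable (fun u => f u * Ring.inverse (u - u₀) ^ (m + 1)) Γ ∧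
        pathIntegral (fun u => f u * Ring.inverse (u - u₀) ^ (m + 1)) Γ =
          (2 * Real.pi / (m.factorial : ℝ)) • (iteratedPolarDeriv m f u₀ * intSum u₀ Γ) := by
      intro m
      obtain ⟨h1, h2⟩ := pathIntegral_laurent hΓ hor (hunit hu) fun u hu' =>
        hasSum_mul_inverse_pow (hunit hu u hu') (hf u (hΓS hu')) m
      refine ⟨pathIntegrable_of_continuousOn hΓ h1, h2.trans ?_⟩
      -- The coefficient of exponent -1 in the shifted series is c_m.
      have he : (-1 + ((m : ℤ) + 1)).toNat = m := by omega
      have hm : (m.factorial : ℝ) ≠ 0 := by positivity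
      rw [iteratedPolarDeriv_center hnear, smul_mul_assoc, smul_smul, div_mul_cancel₀ _ hm,
        if_pos (by omega), he, mul_comm (intSum u₀ Γ)]
    refine ⟨?_, fun m => ⟨eventually_hasPolarDerivAt_iteratedPolarDeriv hnear m, key m⟩⟩
    have h0 := key 0
    simpa only [zero_add, pow_one, Nat.factorial_zero, Nat.cast_one, div_one, iteratedPolarDeriv,
      Function.iterate_zero, id] using h0
  · have hl := fun l => pathIntegral_laurent hΓ hor (hunit (hu l)) (hF l)
    refine ⟨pathIntegrable_of_continuousOn hΓ
      (continuousOn_of_hasSumUniformlyOn (fun l => (hl l).1) hf), ?_⟩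
    simpa only [(hl _).2] using hasSum_pathIntegral hΓ (fun l => (hl l).1) hf
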